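/- Consider $m$ elementary hypotheses $H_1,\dots,H_m$, each examined in a primary study ($i=1$) and in a follow-up study ($i=2$). Let $h_{ij}\in\{0,1\}$ indicate that $H_j$ is false in study $i$, and let $P_{ij}\in[0,1]$ be the $p$-value of $H_j$ in study $i$, so that $\Pr(P_{ij}\le x)\le x$ for all $x\in[0,1]$ whenever $h_{ij}=0$. The no replicability null hypothesis $H_{NR,j}$ states that $(h_{1j},h_{2j})\ne(1,1)$. Write $P_i=(P_{i1},\dots,P_{im})$. A selection rule is a (measurable) map $\mathcal R_1$ from $[0,1]^m$ to the subsets of $\{1,\dots,m\}$, applied to $P_1$. It is *valid* if changing a single coordinate $p_{1j}$, where $j$ is selected before and after the change, does not change the selected set. Given $0<q_1<q<1$ and $c>0$, the two stage procedure with primary level $c$ selects $\mathcal R_1=\mathcal R_1(P_1)$, puts $$R_2=\max\Big\{r\ge 0:\ \#\big\{j\in\mathcal R_1:\ P_{1j}\le \tfrac{rc}{m},\ P_{2j}\le\tfrac{r(q-q_1)}{|\mathcal R_1|}\big\}=r\Big\},$$ and rejects $H_{NR,j}$ for $j\in\mathcal R_2=\{j\in\mathcal R_1: P_{1j}\le \frac{R_2c}{m},\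 P_{2j}\le\frac{R_2(q-q_1)}{|\mathcal R_1|}\}$. Its false discovery rate is $$\mathrm{FDR}=E\left[\frac{\#\{j\in\mathcal R_2: (h_{1j},h_{2j})\neq(1,1)\}}{\max(|\mathcal R_2|,1)}\right].$$ **Theorem.** Suppose that $P_2$ is independent of $P_1$ and has property PRDS: for every (measurable) increasing set $D\subseteq\mathbb R^m$ and every $j$ with $h_{2j}=0$, $\Pr(P_2\in D\mid P_{2j}=p)$ is nondecreasing in $p$ (up to null sets of the law of $P_{2j}$). The dependence among $P_{11},\dots,P_{1m}$ is arbitrary. Let the selection rule be valid. Then: 1. With $c=q_1/\sum_{i=1}^m \frac1i$, the procedure satisfies $\mathrm{FDR}\le q$. 2. If $t<q_1/\big(1+\sum_{i=1}^{m-1}\frac1i\big)$ is a fixed threshold such that only hypotheses with $P_{1j}\le t$ are selected, i.e. $\mathcal R_1\subseteq\{j:P_{1j}\le t\}$, then the maximum $$\tilde q_1=\max\Big\{x:\ x\Big(1+\sum_{i=1}^{\lceil tm/x-1\rceil}\tfrac1i\Big)=q_1\Big\}$$ exists, and with $c=\tilde q_1$ the procedure satisfies $\mathrm{FDR}\le q$.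 -/

import Mathlib

open MeasureTheory ProbabilityTheory

/-- `P j` is the p-value of the `j`-th elementary hypothesis in one study, and `h j` is the indicator
that this hypothesis is false in that study. P-values are random variables with values in `[0, 1]`,
and the p-value of a true null hypothesis is stochastically no smaller than a uniform variable. -/
structure IsPValueFamily {Ω : Type*} [MeasurableSpace Ω] {m : ℕ} (μ : Measure Ω)
    (P : Fin m → Ω → ℝ) (h : Fin m → Fin 2) : Prop where
  measurable : ∀ j, Measurable (P j)
  mem_Icc : ∀ j ω, P j ω ∈ Set.Icc (0 : ℝ) 1
  null : ∀ j, h j = 0 → ∀ x ∈ Set.Icc (0 : ℝ) 1, μ.real {ω | P j ω ≤ x} ≤ x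

/-- Property PRDS: for every (measurable) increasing set `D` and every true null hypothesis `i`,
`p ↦ Pr ((P₁, …, P_m) ∈ D | P_i = p)` is nondecreasing. The conditional probability is the regular
conditional distribution, which is determined up to null sets of the law of `P_i` only, so it is
required to agree almost everywhere with a nondecreasing function. -/
def IsPRDS {Ω : Type*} [MeasurableSpace Ω] {m : ℕ} (μ : Measure Ω) [IsFiniteMeasure μ]
    (P : Fin m → Ω → ℝ) (h : Fin m → Fin 2) : Prop :=
  ∀ D : Set (Fin m → ℝ), MeasurableSet D → IsUpperSet D → ∀ i, h i = 0 →
    ∃ g : ℝ → ℝ, Monotone g ∧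
      (fun p => (condDistrib (fun ω j => P j ω) (P i) μ p).real D) =ᵐ[μ.map (P i)] g

/-- A selection rule maps the vector of primary study p-values to the set of selected indices.
It is valid if changing a single p-value `p j`, so that `j` is selected before and after the
change, does not change the selected set. -/
def IsValidSelectionRule {m : ℕ} (sel : (Fin m → ℝ) → Finset (Fin m)) : Prop :=
  ∀ p ∈ Set.Icc (0 : Fin m → ℝ) 1, ∀ j, ∀ x ∈ Set.Icc (0 : ℝ) 1,
    j ∈ sel p → j ∈ sel (Function.update p j x) → sel (Function.update p j x) = sel p

/-- The selected indices `j ∈ R₁` with `(p₁ j, p₂ j) ≤ (r a / m, r b / |R₁|)`. -/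
noncomputable def passing {m : ℕ} (a b : ℝ) (R₁ : Finset (Fin m)) (p₁ p₂ : Fin m → ℝ) (r : ℕ) :
    Finset (Fin m) :=
  {j ∈ R₁ | p₁ j ≤ r * a / m ∧ p₂ j ≤ r * b / R₁.card}

/-- `max {r : |passing r| = r}`. For nonnegative `a`, `b` the maximum exists, see
`numRejected_isGreatest`. -/
noncomputable def numRejected {m : ℕ} (a b : ℝ) (R₁ : Finset (Fin m)) (p₁ p₂ : Fin m → ℝ) : ℕ :=
  sSup {r : ℕ | (passing a b R₁ p₁ p₂ r).card = r}

/-- The set of indices of the no replicability null hypotheses rejected by the two stage procedure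
with primary thresholds `r a / m`, follow-up thresholds `r b / |R₁|` and selection rule `sel`. The
unmodified procedure with parameters `(q₁, q)` has `a = q₁` and `b = q - q₁`. -/
noncomputable def rejected {m : ℕ} (a b : ℝ) (sel : (Fin m → ℝ) → Finset (Fin m))
    (p₁ p₂ : Fin m → ℝ) : Finset (Fin m) :=
  passing a b (sel p₁) p₁ p₂ (numRejected a b (sel p₁) p₁ p₂)

/-- The true no replicability null hypotheses: the indices `j` for which the elementary hypothesis
is true in at least one of the studies. -/
def noRepNulls {m : ℕ} (h₁ h₂ : Fin m → Fin 2) : Finset (Fin m) :=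
  {j | (h₁ j, h₂ j) = (0, 0) ∨ (h₁ j, h₂ j) = (0, 1) ∨ (h₁ j, h₂ j) = (1, 0)}

/-- The false discovery rate of the two stage procedure for the family of no replicability null
hypotheses: the expectation of (number of false rejections) / max (number of rejections, 1). -/
noncomputable def fdr {Ω : Type*} [MeasurableSpace Ω] {m : ℕ} (μ : Measure Ω)
    (h₁ h₂ : Fin m → Fin 2) (P₁ P₂ : Fin m → Ω → ℝ) (sel : (Fin m → ℝ) → Finset (Fin m))
    (a b : ℝ) : ℝ :=
  ∫ ω, ((rejected a b sel (fun j => P₁ j ω) (fun j => P₂ j ω) ∩ noRepNulls h₁ h₂).card : ℝ) /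
    max ((rejected a b sel (fun j => P₁ j ω) (fun j => P₂ j ω)).card : ℝ) 1 ∂μ

theorem passing_mono {m : ℕ} {a b : ℝ} (ha : 0 ≤ a) (hb : 0 ≤ b) (R₁ : Finset (Fin m))
    (p₁ p₂ : Fin m → ℝ) : Monotone (passing a b R₁ p₁ p₂) := by
  intro r s hrs j hj
  have hrs' : (r : ℝ) ≤ s := by exact_mod_cast hrs
  simp only [passing, Finset.mem_filter] at hj ⊢
  refine ⟨hj.1, hj.2.1.trans ?_, hj.2.2.trans ?_⟩ <;> gcongr

theorem numRejected_isGreatest {m : ℕ} {a b : ℝ} (ha : 0 ≤ a) (hb : 0 ≤ b)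
    (R₁ : Finset (Fin m)) (p₁ p₂ : Fin m → ℝ) :
    IsGreatest {r : ℕ | (passing a b R₁ p₁ p₂ r).card = r} (numRejected a b R₁ p₁ p₂) := by
  have hle : ∀ r, (passing a b R₁ p₁ p₂ r).card ≤ R₁.card := fun r =>
    Finset.card_le_card (Finset.filter_subset _ _)
  have hbdd : BddAbove {r : ℕ | (passing a b R₁ p₁ p₂ r).card = r} :=
    ⟨R₁.card, fun r hr => by rw [← (show _ = r from hr)]; exact hle r⟩
  have hbdd' : BddAbove {r : ℕ | r ≤ (passing a b R₁ p₁ p₂ r).card} :=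
    ⟨R₁.card, fun r hr => le_trans hr (hle r)⟩
  have hmem := Nat.sSup_mem (s := {r : ℕ | r ≤ (passing a b R₁ p₁ p₂ r).card})
    ⟨0, Nat.zero_le _⟩ hbdd'
  have hfix : (passing a b R₁ p₁ p₂
      (sSup {r : ℕ | r ≤ (passing a b R₁ p₁ p₂ r).card})).card =
      sSup {r : ℕ | r ≤ (passing a b R₁ p₁ p₂ r).card} :=
    le_antisymm
      (le_csSup hbdd' (Finset.card_le_card (passing_mono ha hb R₁ p₁ p₂ hmem))) hmem
  exact ⟨Nat.sSup_mem ⟨_, hfix⟩ hbdd, fun r hr => le_csSup hbdd hr⟩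

/-! The false discovery proportion is the sum over true no replicability nulls of the weight 1{j
rejected}/R₂, and each such j is a true null in at least one study. A union bound therefore splits
the FDR into a primary sum (h₁ j = 0) and a follow-up sum (h₂ j = 0). In the primary sum nothing is
known about the dependence of R₂ and P₁ j, so each weight costs (c/m) times a harmonic sum up to K,
where rejection forces P₁ j ≤ Kc/m (`integral_le_mul_harmonic`). The level c is tuned so that the
total is at most q₁. In the follow-up sum, independence allows P₁ to be frozen, which makes the
selected set deterministic. R₂ is then nonincreasing in P₂, and PRDS bounds each selected weight by
(q - q₁)/|R₁| with no harmonic loss (`integral_le_of_positive_dependence`). Summing over R₁ gives q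
- q₁. -/

/-! ### Expected weights under arbitrary dependence. -/

/-- For r ≤ K, 1/r = 1/K + ∑_{r ≤ k < K} (1/k - 1/(k+1)), and x ≤ cr switches on every indicator
with k ≥ r; for r > K the first term suffices. A random r is thus replaced by fixed events x ≤ ck.
-/
theorem inv_le_harmonic_telescope {x c : ℝ} (hc : 0 ≤ c) {K r : ℕ} (hK : 1 ≤ K) (hr : 1 ≤ r)
    (hxr : x ≤ c * r) (hxK : x ≤ c * K) :
    1 / (r : ℝ) ≤ (if x ≤ c * K then 1 / (K : ℝ) else 0) +
      ∑ k ∈ Finset.Ico 1 K, if x ≤ c * k then (1 / (k : ℝ) - 1 / ((k : ℝ) + 1)) else 0 := by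
  have hpos : ∀ k : ℕ, 1 ≤ k → 0 ≤ 1 / (k : ℝ) - 1 / ((k : ℝ) + 1) := fun k hk => by
    have : (0 : ℝ) < k := by exact_mod_cast hk
    rw [sub_nonneg]
    gcongr
    linarith
  have hnonneg : ∀ K : ℕ, 0 ≤ ∑ k ∈ Finset.Ico 1 K,
      if x ≤ c * k then (1 / (k : ℝ) - 1 / ((k : ℝ) + 1)) else 0 := fun K =>
    Finset.sum_nonneg fun k hk => by
      split_ifs
      · exact hpos k (Finset.mem_Ico.1 hk).1
      · exact le_rfl
  rcases le_total r K with h | h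
  · clear hxK hK
    induction K, h using Nat.le_induction with
    | base => rw [if_pos hxr]; linarith [hnonneg r]
    | succ K hrK ih =>
      have hrK' : (r : ℝ) ≤ K := by exact_mod_cast hrK
      have hxK : x ≤ c * K := hxr.trans (by gcongr)
      have hxK' : x ≤ c * ((K + 1 : ℕ) : ℝ) := hxK.trans (by push_cast; gcongr; linarith)
      rw [Finset.sum_Ico_succ_top (by omega), if_pos hxK, if_pos hxK']
      rw [if_pos hxK] at ih
      push_cast
      linarith
  · rw [if_pos hxK]
    have : 1 / (r : ℝ) ≤ 1 / (K : ℝ) := by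
      have : (0 : ℝ) < K := by exact_mod_cast hK
      gcongr
    linarith [hnonneg K]

theorem one_add_sum_Ico_inv_succ (K : ℕ) :
    1 + ∑ k ∈ Finset.Ico 1 (K + 1), 1 / ((k : ℝ) + 1) =
      ∑ i ∈ Finset.Icc 1 (K + 1), 1 / (i : ℝ) := by
  induction K with
  | zero => simp
  | succ K ih =>
    rw [Finset.sum_Ico_succ_top (by omega), ← add_assoc, ih,
      Finset.sum_Icc_succ_top (by omega : 1 ≤ K + 1 + 1)]
    push_cast
    ring

/-- The Benjamini–Yekutieli bound under arbitrary dependence. -/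
theorem integral_le_mul_harmonic {Ω : Type*} [MeasurableSpace Ω] {μ : Measure Ω}
    [IsProbabilityMeasure μ] {X f : Ω → ℝ} (hX : Measurable X)
    (hnull : ∀ x, 0 ≤ x → μ.real {ω | X ω ≤ x} ≤ x) {c : ℝ} (hc : 0 ≤ c) {K : ℕ} (hK : 1 ≤ K)
    (hf : ∀ ω, 0 ≤ f ω)
    (hfX : ∀ ω, f ω ≠ 0 → X ω ≤ c * K ∧ ∃ r : ℕ, 1 ≤ r ∧ X ω ≤ c * r ∧ f ω ≤ 1 / (r : ℝ)) :
    ∫ ω, f ω ∂μ ≤ c * ∑ i ∈ Finset.Icc 1 K, 1 / (i : ℝ) := by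
  have hms : ∀ x, MeasurableSet {ω | X ω ≤ x} := fun x => measurableSet_le hX measurable_const
  have hind : ∀ x y : ℝ, (fun ω => if X ω ≤ x then y else 0) =
      {ω | X ω ≤ x}.indicator fun _ => y := fun x y => by
    ext ω; simp [Set.indicator_apply]
  have hint : ∀ x y : ℝ, Integrable (fun ω => if X ω ≤ x then y else 0) μ := fun x y => by
    rw [hind]; exact (integrable_const y).indicator (hms x)
  have hval : ∀ x y : ℝ, ∫ ω, (if X ω ≤ x then y else 0) ∂μ = μ.real {ω | X ω ≤ x} * y :=
    fun x y => by rw [hind, integral_indicator_const _ (hms x), smul_eq_mul]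
  have hpt : ∀ ω, f ω ≤ (if X ω ≤ c * K then 1 / (K : ℝ) else 0) +
      ∑ k ∈ Finset.Ico 1 K, if X ω ≤ c * k then (1 / (k : ℝ) - 1 / ((k : ℝ) + 1)) else 0 := by
    intro ω
    by_cases h0 : f ω = 0
    · rw [h0]
      refine add_nonneg (by split_ifs <;> positivity) (Finset.sum_nonneg fun k hk => ?_)
      have : (0 : ℝ) < k := by exact_mod_cast (Finset.mem_Ico.1 hk).1
      split_ifs
      · rw [sub_nonneg]
        gcongr
        linarith
      · exact le_rfl
    · obtain ⟨hxK, r, hr, hxr, hfr⟩ := hfX ω h0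
      exact hfr.trans (inv_le_harmonic_telescope hc hK hr hxr hxK)
  have hsum := integrable_finsetSum (μ := μ) (Finset.Ico 1 K)
    fun k _ => hint (c * k) (1 / (k : ℝ) - 1 / ((k : ℝ) + 1))
  refine (integral_mono_of_nonneg (.of_forall hf)
    ((hint (c * K) (1 / (K : ℝ))).add hsum) (.of_forall hpt)).trans ?_
  simp only [Pi.add_apply]
  rw [integral_add (hint _ _) hsum, integral_finsetSum _ fun k _ => hint _ _, hval]
  simp only [hval]
  have hK' : (0 : ℝ) < K := by exact_mod_cast hK
  -- The null bound replaces each probability by its threshold. Then cK · 1/K = c and ck(1/k -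
  -- 1/(k+1)) = c/(k+1), which add up to the harmonic sum.
  calc _ ≤ c * K * (1 / (K : ℝ)) +
        ∑ k ∈ Finset.Ico 1 K, c * k * (1 / (k : ℝ) - 1 / ((k : ℝ) + 1)) := by
        gcongr with k hk
        · exact hnull _ (by positivity)
        · have : (0 : ℝ) < k := by exact_mod_cast (Finset.mem_Ico.1 hk).1
          rw [sub_nonneg]
          gcongr
          linarith
        · exact hnull _ (by positivity)
    _ = c * (1 + ∑ k ∈ Finset.Ico 1 K, 1 / ((k : ℝ) + 1)) := by
        rw [mul_add, Finset.mul_sum]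
        congr 1
        · field_simp
        · refine Finset.sum_congr rfl fun k hk => ?_
          have : (0 : ℝ) < k := by exact_mod_cast (Finset.mem_Ico.1 hk).1
          field_simp
          ring
    _ = _ := by
        obtain ⟨n, rfl⟩ : ∃ n, K = n + 1 := ⟨K - 1, by omega⟩
        rw [one_add_sum_Ico_inv_succ]

/-! ### Expected weights under positive dependence. -/

/-- The Benjamini–Yekutieli bound under positive regression dependence. -/
theorem integral_le_of_positive_dependence {Ω : Type*} [MeasurableSpace Ω] {μ : Measure Ω}
    [IsProbabilityMeasure μ] {X : Ω → ℝ} {R : Ω → ℕ} (hX : Measurable X) (hR : Measurable R)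
    (hnull : ∀ x, 0 ≤ x → μ.real {ω | X ω ≤ x} ≤ x) {c : ℝ} (hc : 0 ≤ c) {n : ℕ}
    (hn : ∀ ω, R ω ≤ n)
    (hdep : ∀ (r : ℕ) (x y : ℝ), x ≤ y →
      μ.real {ω | R ω ≤ r ∧ X ω ≤ x} * μ.real {ω | X ω ≤ y} ≤
        μ.real {ω | R ω ≤ r ∧ X ω ≤ y} * μ.real {ω | X ω ≤ x}) :
    ∫ ω, (if 1 ≤ R ω ∧ X ω ≤ c * R ω then 1 / (R ω : ℝ) else 0) ∂μ ≤ c := by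
  have hms : ∀ r : ℕ, MeasurableSet {ω | R ω = r + 1 ∧ X ω ≤ c * ((r + 1 : ℕ) : ℝ)} := fun r =>
    (measurableSet_eq_fun hR measurable_const).inter (measurableSet_le hX measurable_const)
  have hpt : ∀ ω, (if 1 ≤ R ω ∧ X ω ≤ c * R ω then 1 / (R ω : ℝ) else 0) =
      ∑ r ∈ Finset.range n, {ω | R ω = r + 1 ∧ X ω ≤ c * ((r + 1 : ℕ) : ℝ)}.indicator
        (fun _ => 1 / ((r + 1 : ℕ) : ℝ)) ω := by
    intro ω
    simp only [Set.indicator_apply, Set.mem_ofPred_eq]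
    rcases Nat.eq_zero_or_pos (R ω) with h | h
    · rw [if_neg (by omega), Finset.sum_eq_zero]
      intro r _
      rw [if_neg (by omega)]
    · obtain ⟨s, hs⟩ : ∃ s, R ω = s + 1 := ⟨R ω - 1, by omega⟩
      rw [Finset.sum_eq_single s]
      · simp [hs]
      · intro r _ hrs
        rw [if_neg (by omega)]
      · intro h'
        have := hn ω
        simp at h'
        omega
  simp_rw [hpt]
  rw [integral_finsetSum _ fun r _ => (integrable_const _).indicator (hms r)]
  simp_rw [integral_indicator_const _ (hms _), smul_eq_mul]
  -- `A r` is P(R ≤ r | X ≤ cr), read as 0 if the condition is null. The event R = r + 1 contributes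
  -- at most c(A(r+1) - A(r)): its factor 1/(r+1) is at most c/P(X ≤ c(r+1)), and `hdep` allows the
  -- threshold in `A r` to be raised to c(r+1). The sum telescopes.
  let A : ℕ → ℝ := fun r => μ.real {ω | R ω ≤ r ∧ X ω ≤ c * r} / μ.real {ω | X ω ≤ c * r}
  have hstep : ∀ r ∈ Finset.range n,
      μ.real {ω | R ω = r + 1 ∧ X ω ≤ c * ((r + 1 : ℕ) : ℝ)} * (1 / ((r + 1 : ℕ) : ℝ)) ≤
        c * (A (r + 1) - A r) := by
    intro r _
    set y : ℝ := c * ((r + 1 : ℕ) : ℝ) with hy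
    have hxy : c * r ≤ y := by rw [hy]; push_cast; gcongr; linarith
    have hr0 : (0 : ℝ) < ((r + 1 : ℕ) : ℝ) := by positivity
    have hy0 : 0 ≤ y := by positivity
    have hFy := hnull y hy0
    have hFxy : μ.real {ω | X ω ≤ c * r} ≤ μ.real {ω | X ω ≤ y} :=
      measureReal_mono fun ω h => le_trans h hxy
    have hsplit : μ.real {ω | R ω ≤ r + 1 ∧ X ω ≤ y} =
        μ.real {ω | R ω ≤ r ∧ X ω ≤ y} + μ.real {ω | R ω = r + 1 ∧ X ω ≤ y} := by
      rw [← measureReal_union _ (hms r)]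
      · congr 1
        ext ω
        simp only [Set.mem_ofPred_eq, Set.mem_union]
        rw [← or_and_right]
        exact and_congr_left fun _ => by omega
      · rw [Set.disjoint_left]
        rintro ω ⟨h1, _⟩ ⟨h2, _⟩
        omega
    have hA1 : A (r + 1) = μ.real {ω | R ω ≤ r + 1 ∧ X ω ≤ y} / μ.real {ω | X ω ≤ y} := rfl
    rcases (measureReal_nonneg (μ := μ) (s := {ω | X ω ≤ y})).eq_or_lt with h0 | h0
    · have h1 : μ.real {ω | X ω ≤ c * r} = 0 := le_antisymm (h0 ▸ hFxy) measureReal_nonneg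
      have h2 : μ.real {ω | R ω = r + 1 ∧ X ω ≤ y} = 0 :=
        le_antisymm (h0 ▸ measureReal_mono fun ω h => h.2) measureReal_nonneg
      simp only [hA1, A]
      rw [h1, h2, ← h0]
      simp
    · have hAr : A r ≤ μ.real {ω | R ω ≤ r ∧ X ω ≤ y} / μ.real {ω | X ω ≤ y} := by
        rcases (measureReal_nonneg (μ := μ) (s := {ω | X ω ≤ c * r})).eq_or_lt with h1 | h1
        · simp only [A]
          rw [← h1, div_zero]
          positivity
        · exact (div_le_div_iff₀ h1 h0).2 (hdep r _ _ hxy)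
      calc _ ≤ c * (μ.real {ω | R ω = r + 1 ∧ X ω ≤ y} / μ.real {ω | X ω ≤ y}) := by
            rw [mul_one_div, div_le_iff₀ hr0, mul_comm c, mul_assoc, ← hy, div_mul_eq_mul_div,
              le_div_iff₀ h0]
            gcongr
        _ ≤ _ := by
            gcongr
            rw [hA1, hsplit, add_div]
            linarith
  refine (Finset.sum_le_sum hstep).trans ?_
  rw [← Finset.mul_sum, Finset.sum_range_sub]
  have hAn : A n ≤ 1 := div_le_one_of_le₀ (measureReal_mono fun ω h => h.2) measureReal_nonneg
  have hA0 : 0 ≤ A 0 := by positivity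
  nlinarith

/-- Enlarging {X ≤ x} to {X ≤ y} only adds points where g(X) ≥ g(x), so the average of g(X) cannot
drop. Cross-multiplication avoids conditioning on null events. -/
theorem setIntegral_mul_measureReal_le_of_monotone {Ω : Type*} [MeasurableSpace Ω] {μ : Measure Ω}
    [IsFiniteMeasure μ] {X : Ω → ℝ} (hX : Measurable X) {g : ℝ → ℝ} (hg : Monotone g)
    (hint : Integrable (fun ω => g (X ω)) μ) {x y : ℝ} (hxy : x ≤ y) :
    (∫ ω in {ω | X ω ≤ x}, g (X ω) ∂μ) * μ.real {ω | X ω ≤ y} ≤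
      (∫ ω in {ω | X ω ≤ y}, g (X ω) ∂μ) * μ.real {ω | X ω ≤ x} := by
  have hms : ∀ x, MeasurableSet {ω | X ω ≤ x} := fun x => measurableSet_le hX measurable_const
  set A := {ω | X ω ≤ x} with hA
  set B := {ω | X ω ≤ y} with hB
  have hAB : A ⊆ B := fun ω h => le_trans h hxy
  have hd : Disjoint A (B \ A) := Set.disjoint_sdiff_right
  have hmd : MeasurableSet (B \ A) := (hms y).diff (hms x)
  have hμ : μ.real B = μ.real A + μ.real (B \ A) := by
    rw [← measureReal_union hd hmd, Set.union_sdiff_cancel hAB]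
  have hI : ∫ ω in B, g (X ω) ∂μ = (∫ ω in A, g (X ω) ∂μ) + ∫ ω in B \ A, g (X ω) ∂μ := by
    rw [← setIntegral_union hd hmd hint.integrableOn hint.integrableOn, Set.union_sdiff_cancel hAB]
  have h1 : ∫ ω in A, g (X ω) ∂μ ≤ g x * μ.real A := by
    have := setIntegral_mono_on (hint.integrableOn (s := A)) (integrableOn_const (C := g x))
      (hms x) fun ω hω => hg hω
    simpa [mul_comm] using this
  have h2 : g x * μ.real (B \ A) ≤ ∫ ω in B \ A, g (X ω) ∂μ := by
    have := setIntegral_mono_on (integrableOn_const (C := g x)) (hint.integrableOn (s := B \ A))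
      hmd fun ω hω => hg (not_le.1 hω.2).le
    simpa [mul_comm] using this
  rw [hμ, hI]
  have h3 := mul_le_mul_of_nonneg_right h1 (measureReal_nonneg (μ := μ) (s := B \ A))
  have h4 := mul_le_mul_of_nonneg_right h2 (measureReal_nonneg (μ := μ) (s := A))
  linarith

/-- Passes from conditioning on P_i = p to conditioning on P_i ≤ x, by integrating the monotone
version of the conditional probability. -/
theorem IsPRDS.measureReal_mul_le {Ω : Type*} [MeasurableSpace Ω] {m : ℕ} {μ : Measure Ω}
    [IsProbabilityMeasure μ] {P : Fin m → Ω → ℝ} {h : Fin m → Fin 2} (hP : ∀ j, Measurable (P j))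
    (hprds : IsPRDS μ P h) {D : Set (Fin m → ℝ)} (hD : MeasurableSet D) (hDu : IsUpperSet D)
    {i : Fin m} (hi : h i = 0) {x y : ℝ} (hxy : x ≤ y) :
    μ.real {ω | (fun j => P j ω) ∈ D ∧ P i ω ≤ x} * μ.real {ω | P i ω ≤ y} ≤
      μ.real {ω | (fun j => P j ω) ∈ D ∧ P i ω ≤ y} * μ.real {ω | P i ω ≤ x} := by
  obtain ⟨g, hg, hgD⟩ := hprds D hD hDu i hi
  have hPm : Measurable fun ω j => P j ω := measurable_pi_lambda _ hP
  have hae : (fun ω => (condDistrib (fun ω j => P j ω) (P i) μ (P i ω)).real D) =ᵐ[μ]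
      fun ω => g (P i ω) := ae_of_ae_map (hP i).aemeasurable hgD
  have hint : Integrable
      (fun ω => (condDistrib (fun ω j => P j ω) (P i) μ (P i ω)).real D) μ := by
    refine Integrable.of_bound (C := 1) ?_ (.of_forall fun ω => ?_)
    · exact (((Kernel.measurable_coe _ hD).comp (hP i)).ennreal_toReal).aestronglyMeasurable
    · rw [Real.norm_of_nonneg measureReal_nonneg]
      exact measureReal_le_one
  have key : ∀ x, μ.real {ω | (fun j => P j ω) ∈ D ∧ P i ω ≤ x} =
      ∫ ω in {ω | P i ω ≤ x}, g (P i ω) ∂μ := by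
    intro x
    rw [← integral_congr_ae (ae_restrict_of_ae hae)]
    simp only [Measure.real]
    rw [integral_toReal]
    · have := setLIntegral_preimage_condDistrib (μ := μ) (hP i) hPm.aemeasurable hD
        (measurableSet_Iic (a := x))
      rw [show {ω | P i ω ≤ x} = P i ⁻¹' Set.Iic x from rfl, this]
      congr 2
      ext ω
      simp [and_comm]
    · exact ((Kernel.measurable_coe _ hD).comp (hP i)).aemeasurable
    · exact .of_forall fun ω => measure_lt_top _ _
  rw [key, key]
  exact setIntegral_mul_measureReal_le_of_monotone (hP i) hg (hint.congr hae) hxy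

/-! ### Order properties of the number of rejections. -/

theorem passing_subset {m : ℕ} (a b : ℝ) (R₁ : Finset (Fin m)) (p₁ p₂ : Fin m → ℝ) (r : ℕ) :
    passing a b R₁ p₁ p₂ r ⊆ R₁ :=
  Finset.filter_subset _ _

/-- The count of passing indices is monotone in r, so the largest r not exceeding its count is a
fixed point (Knaster–Tarski). Lower bounds thus need only an inequality, not a fixed point. -/
theorem le_numRejected {m : ℕ} {a b : ℝ} (ha : 0 ≤ a) (hb : 0 ≤ b) {R₁ : Finset (Fin m)}
    {p₁ p₂ : Fin m → ℝ} {r : ℕ} (hr : r ≤ (passing a b R₁ p₁ p₂ r).card) :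
    r ≤ numRejected a b R₁ p₁ p₂ := by
  have hbdd : BddAbove {r : ℕ | r ≤ (passing a b R₁ p₁ p₂ r).card} :=
    ⟨R₁.card, fun s hs => le_trans hs (Finset.card_le_card (passing_subset a b R₁ p₁ p₂ s))⟩
  have hmem := Nat.sSup_mem ⟨r, hr⟩ hbdd
  have hfix := le_antisymm
    (le_csSup hbdd (Finset.card_le_card (passing_mono ha hb R₁ p₁ p₂ hmem))) hmem
  exact (le_csSup hbdd hr).trans ((numRejected_isGreatest ha hb R₁ p₁ p₂).2 hfix)

theorem card_passing_numRejected {m : ℕ} {a b : ℝ} (ha : 0 ≤ a) (hb : 0 ≤ b)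
    (R₁ : Finset (Fin m)) (p₁ p₂ : Fin m → ℝ) :
    (passing a b R₁ p₁ p₂ (numRejected a b R₁ p₁ p₂)).card = numRejected a b R₁ p₁ p₂ :=
  (numRejected_isGreatest ha hb R₁ p₁ p₂).1

theorem numRejected_le_card {m : ℕ} {a b : ℝ} (ha : 0 ≤ a) (hb : 0 ≤ b)
    (R₁ : Finset (Fin m)) (p₁ p₂ : Fin m → ℝ) : numRejected a b R₁ p₁ p₂ ≤ R₁.card := by
  rw [← card_passing_numRejected ha hb R₁ p₁ p₂]
  exact Finset.card_le_card (passing_subset _ _ _ _ _ _)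

/-- Makes {R₂ ≤ r} an increasing set of follow-up p-values, to which PRDS applies. -/
theorem numRejected_antitone {m : ℕ} {a b : ℝ} (ha : 0 ≤ a) (hb : 0 ≤ b)
    (R₁ : Finset (Fin m)) (p₁ : Fin m → ℝ) : Antitone (numRejected a b R₁ p₁) := by
  intro p p' hp
  refine le_numRejected ha hb ?_
  conv_lhs => rw [← card_passing_numRejected ha hb R₁ p₁ p']
  refine Finset.card_le_card fun j hj => ?_
  simp only [passing, Finset.mem_filter] at hj ⊢
  exact ⟨hj.1, hj.2.1, (hp j).trans hj.2.2⟩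

/-! ### Measurability of the procedure. -/

theorem measurable_card_of_measurableSet_mem {α ι : Type*} [MeasurableSpace α] [Fintype ι]
    {s : α → Finset ι} (hs : ∀ j, MeasurableSet {x | j ∈ s x}) :
    Measurable fun x => (s x).card := by
  classical
  have : (fun x => (s x).card) = fun x => ∑ j, if j ∈ s x then 1 else 0 := by
    ext x; simp
  rw [this]
  exact Finset.measurable_sum _ fun j _ => Measurable.ite (hs j) measurable_const measurable_const

section Measurability

variable {m : ℕ} {sel : (Fin m → ℝ) → Finset (Fin m)}

theorem measurableSet_mem_passing (hsel : ∀ j, MeasurableSet {p | j ∈ sel p}) (a b : ℝ)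
    (r : ℕ) (j : Fin m) :
    MeasurableSet {z : (Fin m → ℝ) × (Fin m → ℝ) | j ∈ passing a b (sel z.1) z.1 z.2 r} := by
  have hc : Measurable fun z : (Fin m → ℝ) × (Fin m → ℝ) => (((sel z.1).card : ℕ) : ℝ) :=
    measurable_from_nat.comp ((measurable_card_of_measurableSet_mem hsel).comp measurable_fst)
  simp only [passing, Finset.mem_filter]
  refine (measurable_fst (hsel j)).inter (MeasurableSet.inter ?_ ?_)
  · exact measurableSet_le ((measurable_pi_apply j).comp measurable_fst) measurable_const
  · exact measurableSet_le ((measurable_pi_apply j).comp measurable_snd)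
      (measurable_const.div hc)

theorem measurable_numRejected (hsel : ∀ j, MeasurableSet {p | j ∈ sel p}) {a b : ℝ}
    (ha : 0 ≤ a) (hb : 0 ≤ b) :
    Measurable fun z : (Fin m → ℝ) × (Fin m → ℝ) => numRejected a b (sel z.1) z.1 z.2 := by
  refine measurable_to_countable' fun r => ?_
  -- R₂ = r means that r is a fixed point and no larger s is: countably many measurable conditions.
  have : (fun z : (Fin m → ℝ) × (Fin m → ℝ) => numRejected a b (sel z.1) z.1 z.2) ⁻¹' {r} =
      {z | (passing a b (sel z.1) z.1 z.2 r).card = r} ∩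
        ⋂ s : ℕ, ⋂ _ : r < s, {z | (passing a b (sel z.1) z.1 z.2 s).card = s}ᶜ := by
    ext z
    have h := numRejected_isGreatest ha hb (sel z.1) z.1 z.2
    simp only [Set.mem_preimage, Set.mem_singleton_iff, Set.mem_inter_iff, Set.mem_ofPred_eq,
      Set.mem_iInter, Set.mem_compl_iff]
    refine ⟨fun hr => hr ▸ ⟨h.1, fun s hs hs' => hs.not_ge (h.2 hs')⟩, fun ⟨h1, h2⟩ => ?_⟩
    exact le_antisymm (not_lt.1 fun hlt => h2 _ hlt h.1) (h.2 h1)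
  rw [this]
  have hm : ∀ s : ℕ, MeasurableSet {z : (Fin m → ℝ) × (Fin m → ℝ) |
      (passing a b (sel z.1) z.1 z.2 s).card = s} := fun s =>
    measurable_card_of_measurableSet_mem (measurableSet_mem_passing hsel a b s)
      (measurableSet_singleton s)
  exact (hm r).inter (.iInter fun s => .iInter fun _ => (hm s).compl)

theorem measurableSet_mem_rejected (hsel : ∀ j, MeasurableSet {p | j ∈ sel p}) {a b : ℝ}
    (ha : 0 ≤ a) (hb : 0 ≤ b) (j : Fin m) :
    MeasurableSet {z : (Fin m → ℝ) × (Fin m → ℝ) | j ∈ rejected a b sel z.1 z.2} := by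
  have : {z : (Fin m → ℝ) × (Fin m → ℝ) | j ∈ rejected a b sel z.1 z.2} =
      ⋃ r : ℕ, {z | numRejected a b (sel z.1) z.1 z.2 = r} ∩
        {z | j ∈ passing a b (sel z.1) z.1 z.2 r} := by
    ext z
    simp [rejected]
  rw [this]
  exact .iUnion fun r => (measurable_numRejected hsel ha hb (measurableSet_singleton r)).inter
    (measurableSet_mem_passing hsel a b r j)

end Measurability

/-! ### Decomposition of the false discovery proportion into weights. -/

/-- The contribution of hypothesis `j` to the false discovery proportion, if it is a true null. -/
noncomputable def rejectionWeight {m : ℕ} (a b : ℝ) (sel : (Fin m → ℝ) → Finset (Fin m))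
    (p₁ p₂ : Fin m → ℝ) (j : Fin m) : ℝ :=
  if j ∈ rejected a b sel p₁ p₂ then 1 / (numRejected a b (sel p₁) p₁ p₂ : ℝ) else 0

section Weight

variable {m : ℕ} {sel : (Fin m → ℝ) → Finset (Fin m)} {a b : ℝ}

theorem rejectionWeight_nonneg (p₁ p₂ : Fin m → ℝ) (j : Fin m) :
    0 ≤ rejectionWeight a b sel p₁ p₂ j := by
  unfold rejectionWeight
  split_ifs <;> positivity

theorem rejectionWeight_le_one (p₁ p₂ : Fin m → ℝ) (j : Fin m) :
    rejectionWeight a b sel p₁ p₂ j ≤ 1 := by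
  unfold rejectionWeight
  split_ifs
  · rw [one_div]
    exact Nat.cast_inv_le_one _
  · exact zero_le_one

theorem measurable_rejectionWeight (hsel : ∀ j, MeasurableSet {p | j ∈ sel p})
    (ha : 0 ≤ a) (hb : 0 ≤ b) (j : Fin m) :
    Measurable fun z : (Fin m → ℝ) × (Fin m → ℝ) => rejectionWeight a b sel z.1 z.2 j :=
  Measurable.ite (measurableSet_mem_rejected hsel ha hb j)
    (measurable_const.div (measurable_from_nat.comp (measurable_numRejected hsel ha hb)))
    measurable_const

theorem integrable_rejectionWeight {α : Type*} [MeasurableSpace α] {ν : Measure α}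
    [IsFiniteMeasure ν] (hsel : ∀ j, MeasurableSet {p | j ∈ sel p})
    (ha : 0 ≤ a) (hb : 0 ≤ b) (j : Fin m) {Z : α → (Fin m → ℝ) × (Fin m → ℝ)}
    (hZ : Measurable Z) :
    Integrable (fun x => rejectionWeight a b sel (Z x).1 (Z x).2 j) ν :=
  .of_bound (C := 1) ((measurable_rejectionWeight hsel ha hb j).comp hZ).aestronglyMeasurable
    (.of_forall fun x => by
      rw [Real.norm_of_nonneg (rejectionWeight_nonneg _ _ _)]
      exact rejectionWeight_le_one _ _ _)

theorem one_le_numRejected_of_mem (ha : 0 ≤ a) (hb : 0 ≤ b) {p₁ p₂ : Fin m → ℝ} {j : Fin m}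
    (hj : j ∈ rejected a b sel p₁ p₂) : 1 ≤ numRejected a b (sel p₁) p₁ p₂ := by
  rw [← card_passing_numRejected ha hb]
  exact Finset.card_pos.2 ⟨j, hj⟩

theorem fdp_le_sum_rejectionWeight (ha : 0 ≤ a) (hb : 0 ≤ b) (h₁ h₂ : Fin m → Fin 2)
    (p₁ p₂ : Fin m → ℝ) :
    ((rejected a b sel p₁ p₂ ∩ noRepNulls h₁ h₂).card : ℝ) /
        max ((rejected a b sel p₁ p₂).card : ℝ) 1 ≤
      ∑ j with h₁ j = 0, rejectionWeight a b sel p₁ p₂ j +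
        ∑ j with h₂ j = 0, rejectionWeight a b sel p₁ p₂ j := by
  have hle : ∑ j ∈ noRepNulls h₁ h₂, rejectionWeight a b sel p₁ p₂ j ≤
      ∑ j with h₁ j = 0, rejectionWeight a b sel p₁ p₂ j +
        ∑ j with h₂ j = 0, rejectionWeight a b sel p₁ p₂ j := by
    -- Indices null in both studies are counted twice, which only enlarges the bound.
    rw [← Finset.sum_union_inter]
    refine (Finset.sum_le_sum_of_subset_of_nonneg (fun j hj => ?_)
      fun j _ _ => rejectionWeight_nonneg _ _ _).trans
      (le_add_of_nonneg_right (Finset.sum_nonneg fun j _ => rejectionWeight_nonneg _ _ _))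
    simp only [noRepNulls, Finset.mem_filter, Finset.mem_univ, true_and, Prod.mk.injEq] at hj
    simp only [Finset.mem_union, Finset.mem_filter, Finset.mem_univ, true_and]
    tauto
  refine le_trans (le_of_eq ?_) hle
  simp only [rejectionWeight]
  rw [← Finset.sum_filter, Finset.sum_const, nsmul_eq_mul, Finset.filter_mem_eq_inter,
    Finset.inter_comm, mul_one_div]
  have hcard : (rejected a b sel p₁ p₂).card = numRejected a b (sel p₁) p₁ p₂ :=
    card_passing_numRejected ha hb _ _ _
  rcases Nat.eq_zero_or_pos (rejected a b sel p₁ p₂).card with h | h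
  · rw [Finset.card_eq_zero.1 h]
    simp
  · rw [max_eq_left (by exact_mod_cast h), hcard]

end Weight

/-! ### The primary and follow-up contributions to the FDR. -/

section Bounds

variable {Ω : Type*} [MeasurableSpace Ω] {μ : Measure Ω} [IsProbabilityMeasure μ] {m : ℕ}
  {sel : (Fin m → ℝ) → Finset (Fin m)} {a b : ℝ}

/-- Needed because the thresholds of the procedure may exceed 1. -/
theorem IsPValueFamily.measureReal_le {P : Fin m → Ω → ℝ} {h : Fin m → Fin 2}
    (hP : IsPValueFamily μ P h) {j : Fin m} (hj : h j = 0) {x : ℝ} (hx : 0 ≤ x) :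
    μ.real {ω | P j ω ≤ x} ≤ x := by
  rcases le_total x 1 with h1 | h1
  · exact hP.null j hj x ⟨hx, h1⟩
  · exact measureReal_le_one.trans h1

theorem integral_rejectionWeight_le_primary {P₁ P₂ : Fin m → Ω → ℝ} {h₁ : Fin m → Fin 2}
    (hP₁ : IsPValueFamily μ P₁ h₁) (ha : 0 ≤ a) (hb : 0 ≤ b) {j : Fin m} (hj : h₁ j = 0)
    {K : ℕ} (hK : 1 ≤ K)
    (hrej : ∀ ω, j ∈ rejected a b sel (fun j => P₁ j ω) (fun j => P₂ j ω) → P₁ j ω ≤ a / m * K) :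
    ∫ ω, rejectionWeight a b sel (fun j => P₁ j ω) (fun j => P₂ j ω) j ∂μ ≤
      a / m * ∑ i ∈ Finset.Icc 1 K, 1 / (i : ℝ) := by
  refine integral_le_mul_harmonic (hP₁.measurable j) (fun x => hP₁.measureReal_le hj)
    (by positivity) hK (fun ω => rejectionWeight_nonneg _ _ _) fun ω hω => ?_
  have hmem : j ∈ rejected a b sel (fun j => P₁ j ω) (fun j => P₂ j ω) := by
    by_contra hn
    exact hω (if_neg hn)
  refine ⟨hrej ω hmem, _, one_le_numRejected_of_mem ha hb hmem, ?_, (if_pos hmem).le⟩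
  have := (Finset.mem_filter.1 hmem).2.1
  rwa [mul_div_assoc, mul_comm] at this

theorem sum_integral_rejectionWeight_le_primary {P₁ P₂ : Fin m → Ω → ℝ} {h₁ : Fin m → Fin 2}
    (hP₁ : IsPValueFamily μ P₁ h₁) (ha : 0 ≤ a) (hb : 0 ≤ b) {K : ℕ} (hK : m ≠ 0 → 1 ≤ K)
    (hrej : ∀ ω, ∀ j ∈ rejected a b sel (fun j => P₁ j ω) (fun j => P₂ j ω),
      P₁ j ω ≤ a / m * K) :
    ∑ j with h₁ j = 0, ∫ ω, rejectionWeight a b sel (fun j => P₁ j ω) (fun j => P₂ j ω) j ∂μ ≤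
      a * ∑ i ∈ Finset.Icc 1 K, 1 / (i : ℝ) := by
  have hH : 0 ≤ ∑ i ∈ Finset.Icc 1 K, 1 / (i : ℝ) := Finset.sum_nonneg fun i _ => by positivity
  rcases Nat.eq_zero_or_pos m with rfl | hm
  · rw [Finset.sum_of_isEmpty]
    positivity
  have hm' : (0 : ℝ) < m := by exact_mod_cast hm
  calc _ ≤ ∑ j : Fin m with h₁ j = 0, a / m * ∑ i ∈ Finset.Icc 1 K, 1 / (i : ℝ) :=
        Finset.sum_le_sum fun j hj => integral_rejectionWeight_le_primary hP₁ ha hb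
          (Finset.mem_filter.1 hj).2 (hK hm.ne') fun ω => hrej ω j
    _ ≤ ∑ j : Fin m, a / m * ∑ i ∈ Finset.Icc 1 K, 1 / (i : ℝ) :=
        Finset.sum_le_sum_of_subset_of_nonneg (Finset.filter_subset _ _)
          fun _ _ _ => by positivity
    _ = _ := by
        rw [Finset.sum_const, Finset.card_univ, Fintype.card_fin, nsmul_eq_mul]
        field_simp

/-- With p₁ fixed, dropping the primary condition leaves 1{R ≥ 1, P₂ j ≤ cR}/R with c = b/|R₁|. If
R₁ is empty, both sides are 0. -/
theorem integral_rejectionWeight_le_follow_up {P₂ : Fin m → Ω → ℝ} {h₂ : Fin m → Fin 2}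
    (hP₂ : IsPValueFamily μ P₂ h₂) (hprds : IsPRDS μ P₂ h₂)
    (hsel : ∀ j, MeasurableSet {p | j ∈ sel p}) (ha : 0 ≤ a) (hb : 0 ≤ b) (p₁ : Fin m → ℝ)
    {j : Fin m} (hj : h₂ j = 0) :
    ∫ ω, rejectionWeight a b sel p₁ (fun j => P₂ j ω) j ∂μ ≤ b / (sel p₁).card := by
  have hP₂m : Measurable fun ω j => P₂ j ω := measurable_pi_lambda _ hP₂.measurable
  have hN : Measurable fun p₂ => numRejected a b (sel p₁) p₁ p₂ :=
    (measurable_numRejected hsel ha hb).comp measurable_prodMk_left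
  have hNP : Measurable fun ω => numRejected a b (sel p₁) p₁ (fun j => P₂ j ω) := hN.comp hP₂m
  refine le_trans (integral_mono_of_nonneg (.of_forall fun ω => rejectionWeight_nonneg _ _ _)
    ?_ (.of_forall ?_)) (integral_le_of_positive_dependence (hP₂.measurable j) hNP
      (fun x => hP₂.measureReal_le hj) (c := b / (sel p₁).card) (by positivity)
      (fun ω => numRejected_le_card ha hb _ _ _) fun r x y hxy =>
        hprds.measureReal_mul_le hP₂.measurable
          (D := {p₂ | numRejected a b (sel p₁) p₁ p₂ ≤ r})
          (hN measurableSet_Iic)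
          (fun p p' hp h => (numRejected_antitone ha hb _ _ hp).trans h) hj hxy)
  · refine .of_bound (C := 1) (Measurable.aestronglyMeasurable ?_) (.of_forall fun ω => ?_)
    · refine Measurable.ite ?_ (measurable_const.div (measurable_from_nat.comp hNP))
        measurable_const
      exact (hNP measurableSet_Ici).inter (measurableSet_le (hP₂.measurable j)
        (measurable_const.mul (measurable_from_nat.comp hNP)))
    · split_ifs
      · rw [one_div, Real.norm_of_nonneg (by positivity)]
        exact Nat.cast_inv_le_one _
      · simp
  · intro ω
    simp only [rejectionWeight]
    split_ifs with h1 h2 h2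
    · exact le_rfl
    · refine absurd ⟨one_le_numRejected_of_mem ha hb h1, ?_⟩ h2
      have := (Finset.mem_filter.1 h1).2.2
      rwa [mul_div_assoc, mul_comm] at this
    · positivity
    · exact le_rfl

theorem sum_integral_rejectionWeight_le_follow_up {P₁ P₂ : Fin m → Ω → ℝ} {h₂ : Fin m → Fin 2}
    (hP₁ : ∀ j, Measurable (P₁ j)) (hP₂ : IsPValueFamily μ P₂ h₂) (hprds : IsPRDS μ P₂ h₂)
    (hindep : IndepFun (fun ω j => P₁ j ω) (fun ω j => P₂ j ω) μ)
    (hsel : ∀ j, MeasurableSet {p | j ∈ sel p}) (ha : 0 ≤ a) (hb : 0 ≤ b) :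
    ∑ j with h₂ j = 0, ∫ ω, rejectionWeight a b sel (fun j => P₁ j ω) (fun j => P₂ j ω) j ∂μ ≤
      b := by
  have hP₁m : Measurable fun ω j => P₁ j ω := measurable_pi_lambda _ hP₁
  have hP₂m : Measurable fun ω j => P₂ j ω := measurable_pi_lambda _ hP₂.measurable
  have := Measure.isProbabilityMeasure_map (μ := μ) hP₁m.aemeasurable
  have := Measure.isProbabilityMeasure_map (μ := μ) hP₂m.aemeasurable
  have hprod := (indepFun_iff_map_prod_eq_prod_map_map hP₁m.aemeasurable hP₂m.aemeasurable).1
    hindep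
  -- Independence makes the joint law a product, so Fubini freezes P₁ at p₁.
  have hfub : ∀ j, ∫ ω, rejectionWeight a b sel (fun j => P₁ j ω) (fun j => P₂ j ω) j ∂μ =
      ∫ p₁, (∫ ω, rejectionWeight a b sel p₁ (fun j => P₂ j ω) j ∂μ)
        ∂(μ.map fun ω j => P₁ j ω) := by
    intro j
    have hw := measurable_rejectionWeight hsel ha hb j
    rw [← integral_map (φ := fun ω => ((fun j => P₁ j ω : Fin m → ℝ), (fun j => P₂ j ω)))
      (f := fun z => rejectionWeight a b sel z.1 z.2 j)
      (hP₁m.prodMk hP₂m).aemeasurable hw.aestronglyMeasurable, hprod,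
      integral_prod _ (integrable_rejectionWeight hsel ha hb j (Z := fun z => z) measurable_id)]
    congr 1
    ext p₁
    exact integral_map hP₂m.aemeasurable (hw.comp measurable_prodMk_left).aestronglyMeasurable
  have hmeas : ∀ j, Integrable
      (fun p₁ => ∫ ω, rejectionWeight a b sel p₁ (fun j => P₂ j ω) j ∂μ)
      (μ.map fun ω j => P₁ j ω) := fun j =>
    (integrable_rejectionWeight (ν := (μ.map fun ω j => P₁ j ω).prod μ) hsel ha hb j
      (Z := fun z => (z.1, fun j => P₂ j z.2))
      (measurable_fst.prodMk (hP₂m.comp measurable_snd))).integral_prod_left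
  simp_rw [hfub]
  rw [← integral_finsetSum _ fun j _ => hmeas j]
  refine (integral_mono (integrable_finsetSum _ fun j _ => hmeas j) (integrable_const b)
    fun p₁ => ?_).trans (by simp)
  calc _ ≤ ∑ j with h₂ j = 0, if j ∈ sel p₁ then b / ((sel p₁).card : ℝ) else 0 := by
        refine Finset.sum_le_sum fun j hj => ?_
        split_ifs with h
        · exact integral_rejectionWeight_le_follow_up hP₂ hprds hsel ha hb p₁
            (Finset.mem_filter.1 hj).2
        · refine (integral_eq_zero_of_ae (.of_forall fun ω => if_neg fun h' => h ?_)).le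
          exact passing_subset _ _ _ _ _ _ h'
    _ ≤ ∑ j, if j ∈ sel p₁ then b / ((sel p₁).card : ℝ) else 0 :=
        Finset.sum_le_sum_of_subset_of_nonneg (Finset.filter_subset _ _)
          fun _ _ _ => by split_ifs <;> positivity
    _ ≤ b := by
        rw [← Finset.sum_filter, Finset.filter_univ_mem, Finset.sum_const, nsmul_eq_mul]
        rcases eq_or_ne ((sel p₁).card : ℝ) 0 with h | h
        · rwa [h, zero_mul]
        · rw [mul_div_cancel₀ _ h]

theorem fdr_le_of_forall_rejected_le {P₁ P₂ : Fin m → Ω → ℝ} {h₁ h₂ : Fin m → Fin 2}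
    (hP₁ : IsPValueFamily μ P₁ h₁) (hP₂ : IsPValueFamily μ P₂ h₂) (hprds : IsPRDS μ P₂ h₂)
    (hindep : IndepFun (fun ω j => P₁ j ω) (fun ω j => P₂ j ω) μ)
    (hsel : ∀ j, MeasurableSet {p | j ∈ sel p}) (ha : 0 ≤ a) (hb : 0 ≤ b) {K : ℕ}
    (hK : m ≠ 0 → 1 ≤ K)
    (hrej : ∀ ω, ∀ j ∈ rejected a b sel (fun j => P₁ j ω) (fun j => P₂ j ω),
      P₁ j ω ≤ a / m * K) :
    fdr μ h₁ h₂ P₁ P₂ sel a b ≤ a * ∑ i ∈ Finset.Icc 1 K, 1 / (i : ℝ) + b := by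
  have hZ : Measurable fun ω => ((fun j => P₁ j ω : Fin m → ℝ), (fun j => P₂ j ω : Fin m → ℝ)) :=
    (measurable_pi_lambda _ hP₁.measurable).prodMk (measurable_pi_lambda _ hP₂.measurable)
  have hint : ∀ j, Integrable
      (fun ω => rejectionWeight a b sel (fun j => P₁ j ω) (fun j => P₂ j ω) j) μ := fun j =>
    integrable_rejectionWeight hsel ha hb j
      (Z := fun ω => ((fun j => P₁ j ω : Fin m → ℝ), (fun j => P₂ j ω : Fin m → ℝ))) hZ
  have hsum : ∀ s : Finset (Fin m), Integrable
      (fun ω => ∑ j ∈ s, rejectionWeight a b sel (fun j => P₁ j ω) (fun j => P₂ j ω) j) μ :=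
    fun s => integrable_finsetSum _ fun j _ => hint j
  have hle : fdr μ h₁ h₂ P₁ P₂ sel a b ≤
      ∫ ω, (∑ j with h₁ j = 0, rejectionWeight a b sel (fun j => P₁ j ω) (fun j => P₂ j ω) j +
        ∑ j with h₂ j = 0, rejectionWeight a b sel (fun j => P₁ j ω) (fun j => P₂ j ω) j) ∂μ := by
    unfold fdr
    apply integral_mono_of_nonneg
    · exact .of_forall fun ω =>
        div_nonneg (Nat.cast_nonneg _) (zero_le_one.trans (le_max_right _ _))
    · exact (hsum _).add (hsum _)
    · exact .of_forall fun ω => fdp_le_sum_rejectionWeight ha hb h₁ h₂ _ _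
  refine hle.trans ?_
  rw [integral_add (hsum _) (hsum _), integral_finsetSum _ fun j _ => hint j,
    integral_finsetSum _ fun j _ => hint j]
  exact add_le_add (sum_integral_rejectionWeight_le_primary hP₁ ha hb hK hrej)
    (sum_integral_rejectionWeight_le_follow_up hP₁.measurable hP₂ hprds hindep hsel ha hb)

end Bounds

/-! ### Existence of the modified primary level. -/

/-- The solutions are the points x = q₁/H(k) with N(x) = k. Since q₁/H(k) decreases in k, the
greatest solution comes from the least k with N(q₁/H(k)) ≤ k; monotonicity turns that inequality
into equality. -/
theorem exists_isGreatest_of_lt_div {m : ℕ} {t q₁ : ℝ} (hq₁ : 0 < q₁)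
    (ht : t < q₁ / (1 + ∑ i ∈ Finset.Icc 1 (m - 1), 1 / (i : ℝ))) :
    ∃ q₁' : ℝ, IsGreatest
      {x : ℝ | x * (1 + ∑ i ∈ Finset.Icc 1 ⌈t * m / x - 1⌉₊, 1 / (i : ℝ)) = q₁} q₁' := by
  classical
  set H : ℕ → ℝ := fun k => 1 + ∑ i ∈ Finset.Icc 1 k, 1 / (i : ℝ) with hH
  set N : ℝ → ℕ := fun x => ⌈t * m / x - 1⌉₊ with hN
  have hHpos : ∀ k, 0 < H k := fun k =>
    add_pos_of_pos_of_nonneg one_pos (Finset.sum_nonneg fun i _ => by positivity)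
  have hHmono : Monotone H := fun k l hkl => by
    simp only [hH]
    gcongr
  have hxpos : ∀ k, 0 < q₁ / H k := fun k => div_pos hq₁ (hHpos k)
  have hxanti : ∀ {k l}, k ≤ l → q₁ / H l ≤ q₁ / H k := fun hkl =>
    div_le_div_of_nonneg_left hq₁.le (hHpos _) (hHmono hkl)
  have hex : ∃ k, N (q₁ / H k) ≤ k := by
    -- The bound on t says exactly t < q₁/H(m - 1), hence tm/x ≤ m at x = q₁/H(m - 1).
    refine ⟨m - 1, Nat.ceil_le.2 ?_⟩
    have h1 : t * m / (q₁ / H (m - 1)) ≤ m := by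
      rw [div_le_iff₀ (hxpos _), mul_comm]
      exact mul_le_mul_of_nonneg_left ht.le (Nat.cast_nonneg _)
    have h2 : (m : ℝ) ≤ ((m - 1 : ℕ) : ℝ) + 1 := by
      exact_mod_cast (by omega : m ≤ m - 1 + 1)
    linarith
  have hfix : N (q₁ / H (Nat.find hex)) = Nat.find hex := by
    refine le_antisymm (Nat.find_spec hex) (not_lt.1 fun hlt => ?_)
    obtain ⟨k, hk⟩ : ∃ k, Nat.find hex = k + 1 := ⟨Nat.find hex - 1, by omega⟩
    have h1 : ¬ N (q₁ / H k) ≤ k := Nat.find_min hex (by omega)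
    rw [hk] at hlt
    have h2 : N (q₁ / H (k + 1)) ≤ k := by omega
    rw [Nat.ceil_le, sub_le_iff_le_add, div_le_iff₀ (hxpos _)] at h1 h2
    exact h1 (h2.trans (mul_le_mul_of_nonneg_left (hxanti (Nat.le_succ k)) (by positivity)))
  refine ⟨q₁ / H (Nat.find hex), ?_, fun y hy => ?_⟩
  · change q₁ / H (Nat.find hex) * H (N (q₁ / H (Nat.find hex))) = q₁
    rw [hfix, div_mul_cancel₀ _ (hHpos _).ne']
  · have hy' : y = q₁ / H (N y) := (eq_div_iff (hHpos _).ne').2 hy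
    have hle : Nat.find hex ≤ N y := Nat.find_min' hex (by rw [← hy'])
    rw [hy']
    exact hxanti hle

/-! ### The theorem. -/

theorem theorem3p3 {Ω : Type*} [MeasurableSpace Ω] (μ : Measure Ω) [IsProbabilityMeasure μ]
    (m : ℕ) (h₁ h₂ : Fin m → Fin 2) (P₁ P₂ : Fin m → Ω → ℝ)
    (hP₁ : IsPValueFamily μ P₁ h₁) (hP₂ : IsPValueFamily μ P₂ h₂)
    (hindep : IndepFun (fun ω j => P₁ j ω) (fun ω j => P₂ j ω) μ)
    (hprds : IsPRDS μ P₂ h₂)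
    (sel : (Fin m → ℝ) → Finset (Fin m)) (hsel_meas : ∀ j, MeasurableSet {p | j ∈ sel p})
    (hsel : IsValidSelectionRule sel)
    (q₁ q : ℝ) (hq₁ : 0 < q₁) (hq₁q : q₁ < q) (hq : q < 1) :
    fdr μ h₁ h₂ P₁ P₂ sel (q₁ / ∑ i ∈ Finset.Icc 1 m, 1 / (i : ℝ)) (q - q₁) ≤ q ∧
    ∀ t : ℝ, t < q₁ / (1 + ∑ i ∈ Finset.Icc 1 (m - 1), 1 / (i : ℝ)) →
      (∀ ω, ∀ j ∈ sel (fun j => P₁ j ω), P₁ j ω ≤ t) →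
      ∃ q₁' : ℝ,
        IsGreatest {x : ℝ | x * (1 + ∑ i ∈ Finset.Icc 1 ⌈t * m / x - 1⌉₊, 1 / (i : ℝ)) = q₁} q₁' ∧
        fdr μ h₁ h₂ P₁ P₂ sel q₁' (q - q₁) ≤ q := by

  have hb : 0 ≤ q - q₁ := by linarith
  constructor
  · have ha : 0 ≤ q₁ / ∑ i ∈ Finset.Icc 1 m, 1 / (i : ℝ) :=
      div_nonneg hq₁.le (Finset.sum_nonneg fun i _ => by positivity)
    refine (fdr_le_of_forall_rejected_le hP₁ hP₂ hprds hindep hsel_meas ha hb (K := m)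
      (fun h => Nat.one_le_iff_ne_zero.2 h) fun ω j hj => ?_).trans ?_
    · have hle := (Finset.mem_filter.1 hj).2.1
      have hm : numRejected (q₁ / ∑ i ∈ Finset.Icc 1 m, 1 / (i : ℝ)) (q - q₁)
          (sel fun j => P₁ j ω) (fun j => P₁ j ω) (fun j => P₂ j ω) ≤ m :=
        (numRejected_le_card ha hb _ _ _).trans (card_finset_fin_le _)
      rw [mul_div_assoc, mul_comm] at hle
      exact hle.trans (mul_le_mul_of_nonneg_left (by exact_mod_cast hm) (by positivity))
    · have : q₁ / (∑ i ∈ Finset.Icc 1 m, 1 / (i : ℝ)) * ∑ i ∈ Finset.Icc 1 m, 1 / (i : ℝ) ≤ q₁ := by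
        -- The harmonic sum vanishes only for m = 0.
        rcases eq_or_ne (∑ i ∈ Finset.Icc 1 m, 1 / (i : ℝ)) 0 with h | h
        · rw [h, mul_zero]
          exact hq₁.le
        · exact (div_mul_cancel₀ _ h).le
      linarith
  · intro t ht hselt
    obtain ⟨x, hx⟩ := exists_isGreatest_of_lt_div hq₁ ht
    refine ⟨x, hx, ?_⟩
    have hxeq : x * (1 + ∑ i ∈ Finset.Icc 1 ⌈t * m / x - 1⌉₊, 1 / (i : ℝ)) = q₁ := hx.1
    have hxpos : 0 < x := pos_of_mul_pos_left (hxeq.symm ▸ hq₁)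
      (add_nonneg zero_le_one (Finset.sum_nonneg fun i _ => by positivity))
    refine (fdr_le_of_forall_rejected_le hP₁ hP₂ hprds hindep hsel_meas hxpos.le hb
      -- This K satisfies K ≥ tm/x, so selection alone already forces P₁ j ≤ t ≤ xK/m.
      (K := ⌈t * m / x - 1⌉₊ + 1) (fun _ => Nat.le_add_left _ _) fun ω j hj => ?_).trans ?_
    · refine (hselt ω j (passing_subset _ _ _ _ _ _ hj)).trans ?_
      have hm : (0 : ℝ) < m := by exact_mod_cast j.pos
      have hceil := Nat.le_ceil (t * m / x - 1)
      rw [sub_le_iff_le_add, div_le_iff₀ hxpos] at hceil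
      rw [div_mul_eq_mul_div, le_div_iff₀ hm]
      push_cast
      linarith
    · have hsucc : ∑ i ∈ Finset.Icc 1 (⌈t * m / x - 1⌉₊ + 1), 1 / (i : ℝ) ≤
          1 + ∑ i ∈ Finset.Icc 1 ⌈t * m / x - 1⌉₊, 1 / (i : ℝ) := by
        rw [Finset.sum_Icc_succ_top (by omega), add_comm, one_div]
        gcongr
        exact Nat.cast_inv_le_one _
      have := mul_le_mul_of_nonneg_left hsucc hxpos.le
      linarith
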